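/- Let $N\in\mathbb N$, $1<p<N<q<p^*:=\frac{Np}{N-p}$ and $0<\kappa<2^{-(N+1)}$, and for $r\ge 1$ let $\Omega_r=\{x\in\mathbb R^N: r<|x|<r+1\}$. There is a constant $\Upsilon>0$, depending only on $N,p,q,\kappa$ (in particular independent of $r\ge1$), such that the following holds for every $r\ge 1$. Let $\varphi:\Omega_r\times[0,\infty)\to[0,\infty)$ be continuous on $\Omega_r\times(0,\infty)$, and put $\Phi(x,t)=\int_0^{|t|}\varphi(x,s)\,s\,ds$ and $\widetilde\Phi(x,s)=\sup_{t\ge0}\{st-\Phi(x,t)\}$. Assume that - $(\varphi_1)$ for each $x\in\Omega_r$, $\varphi(x,\cdot)$ is $C^1$ on $(0,\infty)$; - $(\varphi_2)$ $\varphi(x,t)>0$ and $\partial_t(\varphi(x,t)t)>0$ for $x\in\Omega_r$, $t>0$; - $(\varphi_3)$ $\Phi$ is finite and $p\le \frac{\varphi(x,|t|)|t|^2}{\Phi(x,|t|)}\le q$ for $x\in\Omega_r$, $t\neq0$; - $(\varphi_4)$ $\inf_{x\in\Omega_r}\Phi(x,1)>0$; - $(\varphi_5)$ for each $t_0>0$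 there is $c_0>0$ with $\frac{\Phi(x,t)}{t}\ge c_0$ and $\frac{\widetilde\Phi(x,t)}{t}\ge c_0$ for all $t\ge t_0$, $x\in\Omega_r$; - $(\varphi_{11})$ for all $x\in\Omega_r$, $t\in\mathbb R$, the derivative $\partial_s\Phi(x,t)$ of $\Phi(\cdot,t)$ at $x$ in the radial direction $x/|x|$ exists and $|\partial_s\Phi(x,t)|\le\kappa\,\Phi(x,t)$. (If $\Phi(x,t)=\Psi(|x|,t)$ is radial in $x$, this says $|\partial_s\Psi(s,t)|\le\kappa\Psi(s,t)$ for $r<s<r+1$.) Let $L^\Phi(\Omega_r)$ be the space of measurable functions $f$ with $\int_{\Omega_r}\Phi(x,|f|/\tau)\,dx<\infty$ for some $\tau>0$, with the norm $|f|_\Phi=\inf\{\tau>0:\int_{\Omega_r}\Phi(x,|f|/\tau)\,dx\le1\}$, let $W^{1,\Phi}(\Omega_r)$ be the space of $u\in L^\Phi(\Omega_r)$ whose weak gradient satisfies $|\nabla u|\in L^\Phi(\Omega_r)$, with the norm $|u|_\Phi+|\nabla u|_\Phi$, and let $W^{1,\Phi}_0(\Omega_r)$ be the closure of $C_0^\infty(\Omega_r)$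 in it. Then, for every $u\in W_0^{1,\Phi}(\Omega_r)$, both integrals below are finite and $$\int_{\Omega_r}\Phi(x,|u|)\,dx\le\Upsilon\int_{\Omega_r}\Phi(x,|\nabla u|)\,dx .$$ -/

import Mathlib

open MeasureTheory
open scoped ContDiff

noncomputable section

/-- The annulus `{x ∈ ℝᴺ : r < |x| < r + 1}`. -/
def annulus (N : ℕ) (r : ℝ) : Set (EuclideanSpace ℝ (Fin N)) :=
  {x | r < ‖x‖ ∧ ‖x‖ < r + 1}

section Young

variable {E : Type*}

/-- `Φ(x, t) = ∫₀^{|t|} φ(x, s) s ds`. -/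
def PhiOf (φ : E → ℝ → ℝ) (x : E) (t : ℝ) : ℝ :=
  ∫ s in (0 : ℝ)..|t|, φ x s * s

/-- The complementary function `sup_{t ≥ 0} (s t - Φ(x, t))` of `Φ`. -/
def conjugate (Φ : E → ℝ → ℝ) (x : E) (s : ℝ) : ℝ :=
  sSup ((fun t : ℝ => s * t - Φ x t) '' Set.Ici 0)

end Young

/-- The structural hypotheses on `φ` over `Ω ⊆ ℝᴺ`, with exponents `p`, `q` and constant `κ`.
Only the values `φ x t` with `x ∈ Ω` and `t > 0` matter. -/
structure PhiHyp {N : ℕ} (Ω : Set (EuclideanSpace ℝ (Fin N))) (p q κ : ℝ)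
    (φ : EuclideanSpace ℝ (Fin N) → ℝ → ℝ) : Prop where
  /-- `φ` is continuous for `x ∈ Ω`, `t > 0`. -/
  continuousOn : ContinuousOn (fun z : EuclideanSpace ℝ (Fin N) × ℝ => φ z.1 z.2)
    (Ω ×ˢ Set.Ioi 0)
  /-- `φ(x, ·)` is `C¹` on `(0, ∞)`. -/
  contDiffOn : ∀ x ∈ Ω, ContDiffOn ℝ 1 (φ x) (Set.Ioi 0)
  /-- `φ(x, t) > 0` for `t > 0`. -/
  pos : ∀ x ∈ Ω, ∀ t > 0, 0 < φ x t
  /-- `∂ₜ(φ(x, t) t) > 0` for `t > 0`. -/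
  deriv_pos : ∀ x ∈ Ω, ∀ t > 0, 0 < deriv (fun s => φ x s * s) t
  /-- `p ≤ φ(x, |t|) |t|² / Φ(x, |t|) ≤ q` for `t ≠ 0`.  As `p > 0`, this includes that
  `Φ(x, |t|)` is nonzero, hence that the integral defining it converges. -/
  growth : ∀ x ∈ Ω, ∀ t : ℝ, t ≠ 0 →
    p ≤ φ x |t| * |t| ^ 2 / PhiOf φ x |t| ∧ φ x |t| * |t| ^ 2 / PhiOf φ x |t| ≤ q
  /-- `inf_{x ∈ Ω} Φ(x, 1) > 0`. -/
  inf_pos : ∃ d > 0, IsGLB ((fun x => PhiOf φ x 1) '' Ω) d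
  /-- For each `t₀ > 0`, `Φ(x, t) / t` and `Φ̃(x, t) / t` are bounded below by a positive
  constant, uniformly in `x ∈ Ω` and `t ≥ t₀`. -/
  linear_lower : ∀ t₀ > 0, ∃ c > 0, ∀ t ≥ t₀, ∀ x ∈ Ω,
    c ≤ PhiOf φ x t / t ∧ c ≤ conjugate (PhiOf φ) x t / t
  /-- `|∂ₛΦ| ≤ κ Φ`, where `∂ₛ` is the derivative in the radial direction `x / |x|`
  (if `Φ(x, t) = Ψ(|x|, t)`, this is `∂ₛΨ(s, t)` at `s = |x|`). -/
  radial_deriv : ∀ x ∈ Ω, ∀ t : ℝ,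
    LineDifferentiableAt ℝ (fun y => PhiOf φ y t) x (‖x‖⁻¹ • x) ∧
    |lineDeriv ℝ (fun y => PhiOf φ y t) x (‖x‖⁻¹ • x)| ≤ κ * PhiOf φ x t

section Spaces

variable {N : ℕ} {F : Type*} [NormedAddCommGroup F] [NormedSpace ℝ F]

/-- The modular `∫_Ω Φ(x, |f|) dx ∈ [0, ∞]`. -/
def modular (Φ : EuclideanSpace ℝ (Fin N) → ℝ → ℝ) (Ω : Set (EuclideanSpace ℝ (Fin N)))
    (f : EuclideanSpace ℝ (Fin N) → F) : ENNReal :=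
  ∫⁻ x in Ω, ENNReal.ofReal (Φ x ‖f x‖)

/-- The Musielak–Orlicz space `L^Φ(Ω)` (of scalar or of vector-valued functions). -/
def MemLPhi (Φ : EuclideanSpace ℝ (Fin N) → ℝ → ℝ) (Ω : Set (EuclideanSpace ℝ (Fin N)))
    (f : EuclideanSpace ℝ (Fin N) → F) : Prop :=
  AEStronglyMeasurable f (volume.restrict Ω) ∧
    ∃ τ : ℝ, 0 < τ ∧ modular Φ Ω (fun x => τ⁻¹ • f x) < ⊤

/-- The Luxemburg norm `inf {τ > 0 : ∫_Ω Φ(x, |f| / τ) dx ≤ 1}`, with value `∞` if there is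
no such `τ`. -/
def luxNorm (Φ : EuclideanSpace ℝ (Fin N) → ℝ → ℝ) (Ω : Set (EuclideanSpace ℝ (Fin N)))
    (f : EuclideanSpace ℝ (Fin N) → F) : ENNReal :=
  sInf (ENNReal.ofReal '' {τ : ℝ | 0 < τ ∧ modular Φ Ω (fun x => τ⁻¹ • f x) ≤ 1})

/-- `ψ ∈ C₀^∞(Ω)`. -/
def IsTestFunction (Ω : Set (EuclideanSpace ℝ (Fin N)))
    (ψ : EuclideanSpace ℝ (Fin N) → ℝ) : Prop :=
  ContDiff ℝ ∞ ψ ∧ HasCompactSupport ψ ∧ tsupport ψ ⊆ Ω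

/-- `g` is the weak gradient of `u` in `Ω`: `∫_Ω u ∇ψ = - ∫_Ω ψ g` for all test functions. -/
def IsWeakGradient (Ω : Set (EuclideanSpace ℝ (Fin N))) (u : EuclideanSpace ℝ (Fin N) → ℝ)
    (g : EuclideanSpace ℝ (Fin N) → EuclideanSpace ℝ (Fin N)) : Prop :=
  LocallyIntegrableOn u Ω ∧ LocallyIntegrableOn g Ω ∧
    ∀ ψ : EuclideanSpace ℝ (Fin N) → ℝ, IsTestFunction Ω ψ →
      ∫ x in Ω, u x • gradient ψ x = - ∫ x in Ω, ψ x • g x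

/-- `u ∈ W^{1,Φ}(Ω)`, with weak gradient `g`. -/
def MemW1Phi (Φ : EuclideanSpace ℝ (Fin N) → ℝ → ℝ) (Ω : Set (EuclideanSpace ℝ (Fin N)))
    (u : EuclideanSpace ℝ (Fin N) → ℝ)
    (g : EuclideanSpace ℝ (Fin N) → EuclideanSpace ℝ (Fin N)) : Prop :=
  MemLPhi Φ Ω u ∧ IsWeakGradient Ω u g ∧ MemLPhi Φ Ω g

/-- `u ∈ W₀^{1,Φ}(Ω)`, with weak gradient `g`: `u` lies in the closure of `C₀^∞(Ω)` in
`W^{1,Φ}(Ω)` for the norm `|u|_Φ + |∇u|_Φ`. -/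
def MemW01Phi (Φ : EuclideanSpace ℝ (Fin N) → ℝ → ℝ) (Ω : Set (EuclideanSpace ℝ (Fin N)))
    (u : EuclideanSpace ℝ (Fin N) → ℝ)
    (g : EuclideanSpace ℝ (Fin N) → EuclideanSpace ℝ (Fin N)) : Prop :=
  MemW1Phi Φ Ω u g ∧ ∀ ε : ENNReal, 0 < ε →
    ∃ v : EuclideanSpace ℝ (Fin N) → ℝ, IsTestFunction Ω v ∧
      luxNorm Φ Ω (fun x => u x - v x) + luxNorm Φ Ω (fun x => g x - gradient v x) < ε

end Spaces

end

/-! The inequality is one-dimensional along rays. A test function `v` vanishes at the inner end of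
each ray, so `|v (s • θ)|` is at most the integral of `‖gradient v (t • θ)‖` over `(r, r + 1)`. This
interval has length one, so Jensen's inequality for the convex function `PhiOf φ (s • θ)` moves Φ
inside the integral (`phiOf_intervalIntegral_le`). The integrand still has base point `s • θ`; the
bound on the radial derivative and Grönwall's argument replace it by `t • θ` at the cost of `exp κ`
(`phiOf_smul_le`). For `r ≥ 1` the polar weights `s ^ (N - 1)` and `t ^ (N - 1)` differ by at most
the factor `2 ^ (N - 1)`, so integrating over `s` and the sphere gives a constant independent of `r`
(`modular_le_of_isTestFunction`).

The upper growth exponent `q` gives the doubling bound `phiOf_mul_le`. It makes modulars finite and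
quasi-subadditive, so the estimate passes to the norm closure of the test functions
(`modular_le_of_memW01Phi`). -/

section Poincare

/-! ### Convexity, monotonicity and doubling of Φ in its second variable. -/

namespace PhiHyp

open Set

variable {N : ℕ} {Ω : Set (EuclideanSpace ℝ (Fin N))} {p q κ : ℝ}
  {φ : EuclideanSpace ℝ (Fin N) → ℝ → ℝ} {x : EuclideanSpace ℝ (Fin N)}

theorem phiOf_zero : PhiOf φ x 0 = 0 := by simp [PhiOf]

theorem phiOf_of_nonneg {t : ℝ} (ht : 0 ≤ t) : PhiOf φ x t = ∫ s in (0 : ℝ)..t, φ x s * s := by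
  rw [PhiOf, abs_of_nonneg ht]

theorem phiOf_abs (t : ℝ) : PhiOf φ x |t| = PhiOf φ x t := by simp [PhiOf]

theorem mul_self_pos (h : PhiHyp Ω p q κ φ) (hx : x ∈ Ω) {s : ℝ} (hs : 0 < s) : 0 < φ x s * s :=
  mul_pos (h.pos x hx s hs) hs

theorem mul_self_nonneg (h : PhiHyp Ω p q κ φ) (hx : x ∈ Ω) {s : ℝ} (hs : 0 ≤ s) :
    0 ≤ φ x s * s := by
  rcases hs.eq_or_lt with rfl | hs
  · simp
  · exact (h.mul_self_pos hx hs).le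

theorem phiOf_nonneg (h : PhiHyp Ω p q κ φ) (hx : x ∈ Ω) (t : ℝ) : 0 ≤ PhiOf φ x t :=
  intervalIntegral.integral_nonneg (abs_nonneg t) fun _ hs => h.mul_self_nonneg hx hs.1

theorem phiOf_pos (h : PhiHyp Ω p q κ φ) (hp : 1 < p) (hx : x ∈ Ω) {t : ℝ} (ht : t ≠ 0) :
    0 < PhiOf φ x t := by
  refine (h.phiOf_nonneg hx t).lt_of_ne' fun h0 => ?_
  have := (h.growth x hx t ht).1
  rw [phiOf_abs, h0, div_zero] at this
  linarith

theorem intervalIntegrable (h : PhiHyp Ω p q κ φ) (hp : 1 < p) (hx : x ∈ Ω) {t : ℝ} (ht : 0 ≤ t) :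
    IntervalIntegrable (fun s => φ x s * s) volume 0 t := by
  rcases ht.eq_or_lt with rfl | ht
  · simp
  -- A divergent integral has value 0 by convention, which positivity of Φ excludes.
  by_contra hn
  have h1 := h.phiOf_pos hp hx ht.ne'
  rw [phiOf_of_nonneg ht.le, intervalIntegral.integral_undef hn] at h1
  exact h1.false

theorem continuousOn_mul_self (h : PhiHyp Ω p q κ φ) (hx : x ∈ Ω) :
    ContinuousOn (fun s => φ x s * s) (Ioi 0) :=
  (h.contDiffOn x hx).continuousOn.mul continuousOn_id

theorem hasDerivAt_phiOf (h : PhiHyp Ω p q κ φ) (hp : 1 < p) (hx : x ∈ Ω) {t : ℝ} (ht : 0 < t) :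
    HasDerivAt (PhiOf φ x) (φ x t * t) t := by
  have hc := h.continuousOn_mul_self hx
  have h1 := intervalIntegral.integral_hasDerivAt_right (h.intervalIntegrable hp hx ht.le)
    (hc.stronglyMeasurableAtFilter isOpen_Ioi t ht) (hc.continuousAt (Ioi_mem_nhds ht))
  refine h1.congr_of_eventuallyEq ?_
  filter_upwards [Ioi_mem_nhds ht] with s hs
  exact phiOf_of_nonneg (le_of_lt hs)

theorem continuousOn_phiOf (h : PhiHyp Ω p q κ φ) (hp : 1 < p) (hx : x ∈ Ω) :
    ContinuousOn (PhiOf φ x) (Ici 0) := by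
  intro t ht
  have ht1 : (0 : ℝ) ≤ t + 1 := by have : (0 : ℝ) ≤ t := ht; linarith
  have h1 : ContinuousOn (fun b => ∫ s in (0 : ℝ)..b, φ x s * s) (uIcc 0 (t + 1)) :=
    intervalIntegral.continuousOn_primitive_interval
      (((intervalIntegrable_iff').1 (h.intervalIntegrable hp hx ht1)))
  rw [uIcc_of_le ht1] at h1
  have h2 : ContinuousOn (PhiOf φ x) (Icc 0 (t + 1)) :=
    h1.congr fun s hs => phiOf_of_nonneg hs.1
  refine (h2 t ⟨ht, by linarith⟩).mono_of_mem_nhdsWithin ?_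
  rw [← Ici_inter_Iic]
  exact Filter.inter_mem self_mem_nhdsWithin (mem_nhdsWithin_of_mem_nhds (Iic_mem_nhds (by linarith)))

theorem strictMonoOn_mul_self (h : PhiHyp Ω p q κ φ) (hx : x ∈ Ω) :
    StrictMonoOn (fun s => φ x s * s) (Ioi 0) := by
  refine strictMonoOn_of_deriv_pos (convex_Ioi 0) (h.continuousOn_mul_self hx) ?_
  rw [interior_Ioi]
  exact h.deriv_pos x hx

theorem convexOn_phiOf (h : PhiHyp Ω p q κ φ) (hp : 1 < p) (hx : x ∈ Ω) :
    ConvexOn ℝ (Ici 0) (PhiOf φ x) := by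
  refine MonotoneOn.convexOn_of_deriv (convex_Ici 0) (h.continuousOn_phiOf hp hx) ?_ ?_ <;>
    rw [interior_Ici]
  · exact fun t ht => (h.hasDerivAt_phiOf hp hx ht).differentiableAt.differentiableWithinAt
  · exact (h.strictMonoOn_mul_self hx).monotoneOn.congr
      fun t ht => (h.hasDerivAt_phiOf hp hx ht).deriv.symm

theorem monotoneOn_phiOf (h : PhiHyp Ω p q κ φ) (hp : 1 < p) (hx : x ∈ Ω) :
    MonotoneOn (PhiOf φ x) (Ici 0) := by
  refine monotoneOn_of_deriv_nonneg (convex_Ici 0) (h.continuousOn_phiOf hp hx) ?_ ?_ <;>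
    rw [interior_Ici]
  · exact fun t ht => (h.hasDerivAt_phiOf hp hx ht).differentiableAt.differentiableWithinAt
  · intro t ht
    rw [(h.hasDerivAt_phiOf hp hx ht).deriv]
    exact (h.mul_self_pos hx ht).le

/-- The derivative is `t ^ (-q - 1) * (φ x t * t ^ 2 - q * PhiOf φ x t)`, nonpositive by the upper
growth bound. -/
theorem antitoneOn_phiOf_mul_rpow (h : PhiHyp Ω p q κ φ) (hp : 1 < p) (hx : x ∈ Ω) :
    AntitoneOn (fun t => PhiOf φ x t * t ^ (-q)) (Ioi 0) := by
  have hd : ∀ t > 0, HasDerivAt (fun t => PhiOf φ x t * t ^ (-q))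
      (φ x t * t * t ^ (-q) + PhiOf φ x t * (-q * t ^ (-q - 1))) t := fun t ht =>
    (h.hasDerivAt_phiOf hp hx ht).mul (Real.hasDerivAt_rpow_const (Or.inl ht.ne'))
  refine antitoneOn_of_deriv_nonpos (convex_Ioi 0)
    (fun t ht => (hd t ht).continuousAt.continuousWithinAt) ?_ ?_ <;> rw [interior_Ioi]
  · exact fun t ht => (hd t ht).differentiableAt.differentiableWithinAt
  · intro t (ht : 0 < t)
    rw [(hd t ht).deriv]
    have hg := (h.growth x hx t ht.ne').2
    rw [abs_of_pos ht, div_le_iff₀ (h.phiOf_pos hp hx ht.ne')] at hg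
    have h1 : t ^ (-q) = t ^ (-q - 1) * t := by
      rw [← Real.rpow_add_one ht.ne']; ring_nf
    rw [h1]
    have h2 : 0 < t ^ (-q - 1) := Real.rpow_pos_of_pos ht _
    nlinarith [mul_le_mul_of_nonneg_left hg h2.le]

theorem phiOf_mul_le (h : PhiHyp Ω p q κ φ) (hp : 1 < p) (hx : x ∈ Ω) {l t : ℝ} (hl : 1 ≤ l)
    (ht : 0 ≤ t) : PhiOf φ x (l * t) ≤ l ^ q * PhiOf φ x t := by
  rcases ht.eq_or_lt with rfl | ht
  · simp [phiOf_zero]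
  have hl0 : 0 < l := by linarith
  have h1 := h.antitoneOn_phiOf_mul_rpow hp hx (a := t) (b := l * t) ht (mul_pos hl0 ht)
    (le_mul_of_one_le_left ht.le hl)
  simp only [Real.rpow_neg (mul_pos hl0 ht).le, Real.rpow_neg ht.le,
    Real.mul_rpow hl0.le ht.le] at h1
  have := Real.rpow_pos_of_pos ht q
  have := Real.rpow_pos_of_pos hl0 q
  rw [← div_eq_mul_inv, ← div_eq_mul_inv, div_le_div_iff₀ (by positivity) (by positivity)] at h1
  refine le_of_mul_le_mul_right (a := t ^ q) ?_ ‹_›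
  linarith

theorem phiOf_mul_le_of_le_one (h : PhiHyp Ω p q κ φ) (hp : 1 < p) (hx : x ∈ Ω) {l t : ℝ}
    (hl : 0 ≤ l) (hl1 : l ≤ 1) (ht : 0 ≤ t) : PhiOf φ x (l * t) ≤ l * PhiOf φ x t := by
  have := (h.convexOn_phiOf hp hx).2 (x := t) (y := 0) ht (mem_Ici.2 le_rfl) hl
    (sub_nonneg.2 hl1) (by ring)
  simpa [phiOf_zero] using this

/-- Write `a + b` as twice the midpoint: doubling gives `2 ^ q`, and midpoint convexity does the
rest. -/
theorem phiOf_le_of_le_add (h : PhiHyp Ω p q κ φ) (hp : 1 < p) (hx : x ∈ Ω) {a b c : ℝ}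
    (ha : 0 ≤ a) (hb : 0 ≤ b) (hc : 0 ≤ c) (habc : c ≤ a + b) :
    PhiOf φ x c ≤ 2 ^ q * (PhiOf φ x a + PhiOf φ x b) := by
  have h1 := h.monotoneOn_phiOf hp hx hc (mem_Ici.2 (add_nonneg ha hb)) habc
  have h2 := h.phiOf_mul_le hp hx (l := 2) (t := (a + b) / 2) one_le_two (by positivity)
  have h3 := (h.convexOn_phiOf hp hx).2 ha hb (by norm_num : (0 : ℝ) ≤ 1 / 2)
    (by norm_num : (0 : ℝ) ≤ 1 / 2) (by norm_num)
  have h4 : (1 / 2 : ℝ) • a + (1 / 2 : ℝ) • b = (a + b) / 2 := by simp only [smul_eq_mul]; ring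
  have h5 : 2 * ((a + b) / 2) = a + b := by ring
  rw [h4, smul_eq_mul, smul_eq_mul] at h3
  rw [h5] at h2
  have ha' := h.phiOf_nonneg hx a
  have hb' := h.phiOf_nonneg hx b
  calc PhiOf φ x c ≤ 2 ^ q * PhiOf φ x ((a + b) / 2) := h1.trans h2
    _ ≤ _ := by gcongr; linarith

/-- Jensen's inequality along an interval of length one. -/
theorem phiOf_intervalIntegral_le (h : PhiHyp Ω p q κ φ) (hp : 1 < p) (hx : x ∈ Ω) {r : ℝ}
    {w : ℝ → ℝ} (hw : Continuous w) (hw0 : ∀ s, 0 ≤ w s) :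
    PhiOf φ x (∫ s in Ioo r (r + 1), w s) ≤ ∫ s in Ioo r (r + 1), PhiOf φ x (w s) := by
  have : IsProbabilityMeasure (volume.restrict (Ioo r (r + 1))) := ⟨by simp⟩
  refine (h.convexOn_phiOf hp hx).map_integral_le (h.continuousOn_phiOf hp hx) isClosed_Ici
    (.of_forall hw0) ?_ ?_
  · exact (hw.continuousOn.integrableOn_Icc).mono_set Ioo_subset_Icc_self
  · exact ((((h.continuousOn_phiOf hp hx).comp_continuous hw hw0).continuousOn).integrableOn_Icc
      (a := r) (b := r + 1)).mono_set Ioo_subset_Icc_self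

end PhiHyp

open Set

/-! ### Polar coordinates on the annulus. -/

section Polar

variable {E : Type*} [NormedAddCommGroup E] [NormedSpace ℝ E] [FiniteDimensional ℝ E]
  [MeasurableSpace E] [BorelSpace E] [Nontrivial E]

/-- Integration in polar coordinates. -/
theorem lintegral_eq_lintegral_toSphere (μ : Measure E) [μ.IsAddHaarMeasure] {F : E → ENNReal}
    (hF : Measurable F) :
    ∫⁻ x, F x ∂μ = ∫⁻ θ : Metric.sphere (0 : E) 1, (∫⁻ s in Ioi (0 : ℝ),
      ENNReal.ofReal (s ^ (Module.finrank ℝ E - 1)) * F (s • (θ : E))) ∂μ.toSphere := by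
  have hm : Measurable fun z : Metric.sphere (0 : E) 1 × Ioi (0 : ℝ) =>
      F ((z.2 : ℝ) • (z.1 : E)) := by fun_prop
  calc ∫⁻ x, F x ∂μ = ∫⁻ x : ({(0)}ᶜ : Set E), F x ∂(μ.comap (↑)) := by
        rw [lintegral_subtype_comap (measurableSet_singleton _).compl F, restrict_compl_singleton]
    _ = ∫⁻ z, F ((z.2 : ℝ) • (z.1 : E))
          ∂(μ.toSphere.prod (.volumeIoiPow (Module.finrank ℝ E - 1))) := by
        rw [← μ.measurePreserving_homeomorphUnitSphereProd.lintegral_comp hm]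
        refine lintegral_congr fun x => ?_
        have hx : ‖(x : E)‖ ≠ 0 := norm_ne_zero_iff.2 x.2
        simp [smul_smul, hx]
    _ = _ := by
        rw [lintegral_prod _ hm.aemeasurable]
        refine lintegral_congr fun θ => ?_
        have hθ : Measurable fun s : ℝ => F (s • (θ : E)) := by fun_prop
        refine (lintegral_withDensity_eq_lintegral_mul _ (by fun_prop)
          (hθ.comp measurable_subtype_coe)).trans ?_
        exact lintegral_subtype_comap measurableSet_Ioi
          fun s => ENNReal.ofReal (s ^ (Module.finrank ℝ E - 1)) * F (s • (θ : E))

end Polar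

theorem smul_mem_annulus {N : ℕ} {r s : ℝ} {θ : EuclideanSpace ℝ (Fin N)} (hr : 0 ≤ r)
    (hθ : ‖θ‖ = 1) (hs : s ∈ Ioo r (r + 1)) : s • θ ∈ annulus N r := by
  have : ‖s • θ‖ = s := by rw [norm_smul, hθ, mul_one, Real.norm_of_nonneg (hr.trans hs.1.le)]
  simpa [annulus, this] using hs

theorem isOpen_annulus (N : ℕ) (r : ℝ) : IsOpen (annulus N r) :=
  (isOpen_lt continuous_const continuous_norm).inter (isOpen_lt continuous_norm continuous_const)

/-- Measurability is asked only of the indicator, since `φ` is arbitrary outside the annulus. -/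
theorem setLIntegral_annulus {N : ℕ} (hN : 0 < N) {r : ℝ} (hr : 0 ≤ r)
    {F : EuclideanSpace ℝ (Fin N) → ENNReal} (hF : Measurable ((annulus N r).indicator F)) :
    ∫⁻ x in annulus N r, F x = ∫⁻ θ : Metric.sphere (0 : EuclideanSpace ℝ (Fin N)) 1,
      (∫⁻ s in Ioo r (r + 1), ENNReal.ofReal (s ^ (N - 1)) *
        F (s • (θ : EuclideanSpace ℝ (Fin N)))) ∂(volume : Measure _).toSphere := by
  have : Nonempty (Fin N) := ⟨⟨0, hN⟩⟩
  rw [← lintegral_indicator (isOpen_annulus N r).measurableSet,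
    lintegral_eq_lintegral_toSphere _ hF]
  refine lintegral_congr fun θ => ?_
  have hsub : Ioo r (r + 1) ⊆ Ioi 0 := fun s hs => hr.trans_lt hs.1
  rw [← inter_eq_left.2 hsub, ← Measure.restrict_restrict measurableSet_Ioo,
    ← lintegral_indicator measurableSet_Ioo]
  refine setLIntegral_congr_fun measurableSet_Ioi fun s (hs : 0 < s) => ?_
  have hn : ‖s • (θ : EuclideanSpace ℝ (Fin N))‖ = s := by
    rw [norm_smul, norm_eq_of_mem_sphere, mul_one, Real.norm_of_nonneg hs.le]
  by_cases h : s ∈ Ioo r (r + 1)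
  · have h' := smul_mem_annulus hr (norm_eq_of_mem_sphere θ) h
    simp only [indicator_of_mem h', indicator_of_mem h, finrank_euclideanSpace_fin]
  · have h' : s • (θ : EuclideanSpace ℝ (Fin N)) ∉ annulus N r := by
      simpa [annulus, hn] using h
    simp only [indicator_of_notMem h', indicator_of_notMem h, mul_zero]

/-! ### Radial variation and joint measurability of Φ. -/

namespace PhiHyp

variable {N : ℕ} {p q κ : ℝ} {φ : EuclideanSpace ℝ (Fin N) → ℝ → ℝ}

/-- `Φ` varies at most by the factor `exp κ` along each ray of the annulus. -/
theorem phiOf_smul_le {r : ℝ} (h : PhiHyp (annulus N r) p q κ φ) (hκ : 0 < κ) (hr : 0 ≤ r)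
    {θ : EuclideanSpace ℝ (Fin N)} (hθ : ‖θ‖ = 1) {s s' : ℝ} (hs : s ∈ Ioo r (r + 1))
    (hs' : s' ∈ Ioo r (r + 1)) (t : ℝ) :
    PhiOf φ (s • θ) t ≤ Real.exp κ * PhiOf φ (s' • θ) t := by
  set ψ : ℝ → ℝ := fun s => PhiOf φ (s • θ) t with hψ
  have hd : ∀ a ∈ Ioo r (r + 1), ∃ d, HasDerivAt ψ d a ∧ |d| ≤ κ * ψ a := by
    intro a ha
    have ha0 : 0 < a := hr.trans_lt ha.1
    have hdir : ‖a • θ‖⁻¹ • (a • θ) = θ := by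
      rw [norm_smul, hθ, mul_one, Real.norm_of_nonneg ha0.le, smul_smul, inv_mul_cancel₀ ha0.ne',
        one_smul]
    obtain ⟨h1, h2⟩ := h.radial_deriv _ (smul_mem_annulus hr hθ ha) t
    rw [hdir] at h1 h2
    refine ⟨_, ?_, h2⟩
    have h3 : HasDerivAt (fun b : ℝ => PhiOf φ (a • θ + b • θ) t)
        (lineDeriv ℝ (fun y => PhiOf φ y t) (a • θ) θ) (a - a) := by
      rw [sub_self]; exact h1.hasLineDerivAt
    refine (h3.comp_sub_const a a).congr_of_eventuallyEq (.of_forall fun b => ?_)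
    simp only [hψ, ← add_smul, add_sub_cancel]
  have hψ0 : ∀ a ∈ Ioo r (r + 1), 0 ≤ ψ a := fun a ha =>
    h.phiOf_nonneg (smul_mem_annulus hr hθ ha) t
  have hmain : ∀ c : ℝ, ∀ a ∈ Ioo r (r + 1), ∀ d, HasDerivAt ψ d a →
      HasDerivAt (fun a => ψ a * Real.exp (c * a)) ((d + c * ψ a) * Real.exp (c * a)) a := by
    intro c a _ d hd
    have h4 : HasDerivAt (fun a => Real.exp (c * a)) (Real.exp (c * a) * (c * 1)) a :=
      ((hasDerivAt_id a).const_mul c).exp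
    exact (hd.mul h4).congr_deriv (by ring)
  -- Grönwall in both directions: `|ψ'| ≤ κ ψ` fixes the signs of the derivatives of `ψ a * exp (±κ
  -- a)`.
  have hmono : MonotoneOn (fun a => ψ a * Real.exp (κ * a)) (Ioo r (r + 1)) := by
    refine monotoneOn_of_deriv_nonneg (convex_Ioo _ _) (fun a ha => ?_) ?_ ?_
    · obtain ⟨d, h1, -⟩ := hd a ha
      exact (hmain κ a ha d h1).continuousAt.continuousWithinAt
    all_goals
      rw [interior_Ioo]
      intro a ha
      obtain ⟨d, h1, h2⟩ := hd a ha
    · exact (hmain κ a ha d h1).differentiableAt.differentiableWithinAt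
    · rw [(hmain κ a ha d h1).deriv]
      exact mul_nonneg (by linarith [(abs_le.1 h2).1]) (Real.exp_pos _).le
  have hanti : AntitoneOn (fun a => ψ a * Real.exp (-κ * a)) (Ioo r (r + 1)) := by
    refine antitoneOn_of_deriv_nonpos (convex_Ioo _ _) (fun a ha => ?_) ?_ ?_
    · obtain ⟨d, h1, -⟩ := hd a ha
      exact (hmain (-κ) a ha d h1).continuousAt.continuousWithinAt
    all_goals
      rw [interior_Ioo]
      intro a ha
      obtain ⟨d, h1, h2⟩ := hd a ha
    · exact (hmain (-κ) a ha d h1).differentiableAt.differentiableWithinAt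
    · rw [(hmain (-κ) a ha d h1).deriv]
      exact mul_nonpos_of_nonpos_of_nonneg (by linarith [(abs_le.1 h2).2]) (Real.exp_pos _).le
  have key : ∀ c : ℝ, c * (s' - s) ≤ κ →
      ψ s * Real.exp (c * s) ≤ ψ s' * Real.exp (c * s') → ψ s ≤ Real.exp κ * ψ s' := by
    intro c hc hle
    have h5 : ψ s ≤ ψ s' * Real.exp (c * (s' - s)) := by
      refine le_of_mul_le_mul_right (a := Real.exp (c * s)) ?_ (Real.exp_pos _)
      rwa [mul_assoc, ← Real.exp_add, mul_sub, sub_add_cancel]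
    rw [mul_comm]
    exact h5.trans (mul_le_mul_of_nonneg_left (Real.exp_le_exp.2 hc) (hψ0 s' hs'))
  rcases le_total s s' with hle | hle
  · exact key κ (by nlinarith [hs.1, hs'.2]) (hmono hs hs' hle)
  · exact key (-κ) (by nlinarith [hs'.1, hs.2]) (hanti hs' hs hle)

/-- Φ is a parameter integral of a jointly measurable kernel, cut off to `Ω` and to `0 < s ≤ |t|`,
so Fubini's measurability statement applies. -/
theorem measurable_indicator_phiOf {Ω : Set (EuclideanSpace ℝ (Fin N))} (hΩ : MeasurableSet Ω)
    (h : PhiHyp Ω p q κ φ) :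
    Measurable fun z : EuclideanSpace ℝ (Fin N) × ℝ =>
      Ω.indicator (fun x => PhiOf φ x z.2) z.1 := by
  classical
  have hk : Measurable ((Ω ×ˢ Ioi (0 : ℝ)).indicator fun z => φ z.1 z.2 * z.2) := by
    rw [← piecewise_eq_indicator]
    exact ContinuousOn.measurable_piecewise (h.continuousOn.mul continuousOn_snd)
      continuousOn_const (hΩ.prod measurableSet_Ioi)
  have hK : Measurable ({w : (EuclideanSpace ℝ (Fin N) × ℝ) × ℝ | w.2 ≤ |w.1.2|}.indicator
      fun w => (Ω ×ˢ Ioi (0 : ℝ)).indicator (fun z => φ z.1 z.2 * z.2) (w.1.1, w.2)) :=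
    (hk.comp (by fun_prop)).indicator (measurableSet_le (by fun_prop) (by fun_prop))
  convert (hK.stronglyMeasurable.integral_prod_right' (ν := volume)).measurable using 1
  funext z
  by_cases hz : z.1 ∈ Ω
  · rw [indicator_of_mem hz, PhiOf, intervalIntegral.integral_of_le (abs_nonneg _),
      ← integral_indicator measurableSet_Ioc]
    refine integral_congr_ae (.of_forall fun s => ?_)
    simp only [indicator, mem_ofPred_eq, mem_prod, hz, true_and, mem_Ioi, mem_Ioc]
    split_ifs <;> first | rfl | (exfalso; tauto)
  · rw [indicator_of_notMem hz]
    simp [indicator, hz]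

theorem aemeasurable_phiOf {Ω : Set (EuclideanSpace ℝ (Fin N))} (hΩ : MeasurableSet Ω)
    (h : PhiHyp Ω p q κ φ) {w : EuclideanSpace ℝ (Fin N) → ℝ}
    (hw : AEMeasurable w (volume.restrict Ω)) :
    AEMeasurable (fun x => PhiOf φ x (w x)) (volume.restrict Ω) := by
  refine ((h.measurable_indicator_phiOf hΩ).comp_aemeasurable
    (aemeasurable_id.prodMk hw)).congr ?_
  filter_upwards [ae_restrict_mem hΩ] with x hx
  simp [hx]

theorem measurable_indicator_ofReal_phiOf {Ω : Set (EuclideanSpace ℝ (Fin N))}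
    (hΩ : MeasurableSet Ω) (h : PhiHyp Ω p q κ φ) {w : EuclideanSpace ℝ (Fin N) → ℝ}
    (hw : Measurable w) :
    Measurable (Ω.indicator fun x => ENNReal.ofReal (PhiOf φ x (w x))) := by
  convert ((h.measurable_indicator_phiOf hΩ).comp
    (measurable_id.prodMk hw)).ennreal_ofReal using 1
  funext x
  by_cases hx : x ∈ Ω <;> simp [hx]

end PhiHyp

/-! ### Test functions along rays. -/

section TestFunction

variable {N : ℕ} {v : EuclideanSpace ℝ (Fin N) → ℝ}

theorem continuous_gradient_of_contDiff (hv : ContDiff ℝ ∞ v) : Continuous (gradient v) :=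
  (InnerProductSpace.toDual ℝ _).symm.continuous.comp (hv.continuous_fderiv (by simp))

theorem IsTestFunction.abs_smul_le {r : ℝ} (hr : 0 ≤ r) (hv : IsTestFunction (annulus N r) v)
    {θ : EuclideanSpace ℝ (Fin N)} (hθ : ‖θ‖ = 1) {s : ℝ} (hs : s ∈ Ioo r (r + 1)) :
    |v (s • θ)| ≤ ∫ t in Ioo r (r + 1), ‖gradient v (t • θ)‖ := by
  obtain ⟨hv1, -, hv3⟩ := hv
  -- The point `r • θ` lies on the boundary of the open annulus, hence outside the support.
  have hv0 : v (r • θ) = 0 := by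
    by_contra hne
    have := hv3 (subset_tsupport v hne)
    simp [annulus, norm_smul, hθ, abs_of_nonneg hr] at this
  have hd : ∀ t, HasDerivAt (fun t : ℝ => v (t • θ)) (fderiv ℝ v (t • θ) θ) t := fun t => by
    have h1 := (hv1.differentiable (by simp) (t • θ)).hasFDerivAt
    have h2 : HasDerivAt (fun t : ℝ => t • θ) ((1 : ℝ) • θ) t := (hasDerivAt_id t).smul_const θ
    rw [one_smul] at h2
    exact h1.comp_hasDerivAt t h2
  have hc : Continuous fun t : ℝ => fderiv ℝ v (t • θ) θ :=
    ((hv1.continuous_fderiv (by simp)).comp (by fun_prop)).clm_apply continuous_const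
  have hg : Continuous fun t : ℝ => ‖gradient v (t • θ)‖ :=
    ((continuous_gradient_of_contDiff hv1).comp (by fun_prop)).norm
  have hint := intervalIntegral.integral_eq_sub_of_hasDerivAt (fun t _ => hd t)
    (hc.intervalIntegrable r s)
  rw [hv0, sub_zero] at hint
  rw [← hint, ← Real.norm_eq_abs]
  calc ‖∫ t in r..s, fderiv ℝ v (t • θ) θ‖ ≤ ∫ t in r..s, ‖gradient v (t • θ)‖ := by
        refine intervalIntegral.norm_integral_le_of_norm_le hs.1.le (.of_forall fun t _ => ?_)
          (hg.intervalIntegrable _ _)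
        rw [gradient, LinearIsometryEquiv.norm_map]
        simpa [hθ] using (fderiv ℝ v (t • θ)).le_opNorm θ
    _ ≤ ∫ t in r..(r + 1), ‖gradient v (t • θ)‖ :=
        intervalIntegral.integral_mono_interval le_rfl hs.1.le hs.2.le
          (.of_forall fun _ => norm_nonneg _) (hg.intervalIntegrable _ _)
    _ = _ := by
        rw [intervalIntegral.integral_of_le (by linarith), integral_Ioc_eq_integral_Ioo]

end TestFunction

/-! ### The modular inequality for test functions, and its passage to the closure. -/

namespace PhiHyp

variable {N : ℕ} {p q κ : ℝ} {φ : EuclideanSpace ℝ (Fin N) → ℝ → ℝ}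
  {v : EuclideanSpace ℝ (Fin N) → ℝ}

/-- The base point stays frozen at `s • θ` while Jensen is applied; only then is it moved to `t •
θ`. -/
theorem ofReal_phiOf_smul_le {r : ℝ} (h : PhiHyp (annulus N r) p q κ φ) (hp : 1 < p)
    (hκ : 0 < κ) (hr : 0 ≤ r) (hv : IsTestFunction (annulus N r) v)
    {θ : EuclideanSpace ℝ (Fin N)} (hθ : ‖θ‖ = 1) {s : ℝ} (hs : s ∈ Ioo r (r + 1)) :
    ENNReal.ofReal (PhiOf φ (s • θ) ‖v (s • θ)‖) ≤ ENNReal.ofReal (Real.exp κ) *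
      ∫⁻ t in Ioo r (r + 1), ENNReal.ofReal (PhiOf φ (t • θ) ‖gradient v (t • θ)‖) := by
  have hx := smul_mem_annulus hr hθ hs
  have hg : Continuous fun t : ℝ => ‖gradient v (t • θ)‖ :=
    ((continuous_gradient_of_contDiff hv.1).comp (by fun_prop)).norm
  have h1 : PhiOf φ (s • θ) ‖v (s • θ)‖ ≤
      ∫ t in Ioo r (r + 1), PhiOf φ (s • θ) ‖gradient v (t • θ)‖ :=
    (h.monotoneOn_phiOf hp hx (norm_nonneg _) (setIntegral_nonneg measurableSet_Ioo
      fun _ _ => norm_nonneg _) (hv.abs_smul_le hr hθ hs)).trans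
      (h.phiOf_intervalIntegral_le hp hx hg fun _ => norm_nonneg _)
  have hi : IntegrableOn (fun t : ℝ => PhiOf φ (s • θ) ‖gradient v (t • θ)‖) (Ioo r (r + 1)) :=
    ((((h.continuousOn_phiOf hp hx).comp_continuous hg
      fun _ => norm_nonneg _).continuousOn).integrableOn_Icc).mono_set Ioo_subset_Icc_self
  refine (ENNReal.ofReal_le_ofReal h1).trans ?_
  rw [ofReal_integral_eq_lintegral_ofReal hi (.of_forall fun _ => h.phiOf_nonneg hx _),
    ← lintegral_const_mul' _ _ ENNReal.ofReal_ne_top]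
  refine setLIntegral_mono' measurableSet_Ioo fun t ht => ?_
  rw [← ENNReal.ofReal_mul (Real.exp_pos _).le]
  exact ENNReal.ofReal_le_ofReal (h.phiOf_smul_le hκ hr hθ hs ht _)

/-- The modular Poincaré inequality for test functions. -/
theorem modular_le_of_isTestFunction {r : ℝ} (h : PhiHyp (annulus N r) p q κ φ) (hp : 1 < p)
    (hκ : 0 < κ) (hN : 0 < N) (hr : 1 ≤ r) (hv : IsTestFunction (annulus N r) v) :
    modular (PhiOf φ) (annulus N r) v ≤
      ENNReal.ofReal (Real.exp κ * 2 ^ (N - 1)) *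
        modular (PhiOf φ) (annulus N r) (gradient v) := by
  have hr0 : 0 ≤ r := by linarith
  have hmeas := (isOpen_annulus N r).measurableSet
  have hgm := (continuous_gradient_of_contDiff hv.1).norm.measurable
  rw [modular, modular, setLIntegral_annulus hN hr0
    (h.measurable_indicator_ofReal_phiOf hmeas hv.1.continuous.norm.measurable),
    setLIntegral_annulus hN hr0 (h.measurable_indicator_ofReal_phiOf hmeas hgm),
    ← lintegral_const_mul' _ _ ENNReal.ofReal_ne_top]
  refine lintegral_mono fun θ => ?_
  have hθ : ‖(θ : EuclideanSpace ℝ (Fin N))‖ = 1 := norm_eq_of_mem_sphere θ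
  set G : ℝ → ENNReal := fun t => ENNReal.ofReal (PhiOf φ (t • (θ : EuclideanSpace ℝ (Fin N)))
    ‖gradient v (t • (θ : EuclideanSpace ℝ (Fin N)))‖) with hG
  have key : ∀ s ∈ Ioo r (r + 1), ENNReal.ofReal (s ^ (N - 1)) *
      ENNReal.ofReal (PhiOf φ (s • (θ : EuclideanSpace ℝ (Fin N)))
        ‖v (s • (θ : EuclideanSpace ℝ (Fin N)))‖) ≤
      ENNReal.ofReal (Real.exp κ * 2 ^ (N - 1)) *
        ∫⁻ t in Ioo r (r + 1), ENNReal.ofReal (t ^ (N - 1)) * G t := by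
    intro s hs
    grw [h.ofReal_phiOf_smul_le hp hκ hr0 hv hθ hs]
    rw [← mul_assoc, ← lintegral_const_mul' _ _ (by finiteness),
      ← lintegral_const_mul' _ _ (by finiteness)]
    refine setLIntegral_mono' measurableSet_Ioo fun t ht => ?_
    rw [← mul_assoc]
    refine mul_le_mul_left ?_ _
    rw [← ENNReal.ofReal_mul (pow_nonneg (hr0.trans hs.1.le) _), ← ENNReal.ofReal_mul (by positivity)]
    refine ENNReal.ofReal_le_ofReal ?_
    -- Here `r ≥ 1` enters: `s < r + 1 ≤ 2 * r < 2 * t`.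
    have h1 : s ^ (N - 1) ≤ (2 * t) ^ (N - 1) :=
      pow_le_pow_left₀ (by linarith [hs.1]) (by linarith [hs.2, ht.1]) _
    rw [mul_pow] at h1
    nlinarith [Real.exp_pos κ]
  refine (setLIntegral_mono' measurableSet_Ioo key).trans ?_
  -- The bound in `key` is constant in `s`, and the interval has measure one.
  simp [hG]

/-- By doubling, undoing the scaling by `τ⁻¹` costs at most `max 1 τ ^ q`. -/
theorem modular_lt_top {F : Type*} [NormedAddCommGroup F] [NormedSpace ℝ F]
    {Ω : Set (EuclideanSpace ℝ (Fin N))} (hΩ : MeasurableSet Ω) (h : PhiHyp Ω p q κ φ)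
    (hp : 1 < p) {f : EuclideanSpace ℝ (Fin N) → F}
    (hf : MemLPhi (PhiOf φ) Ω f) : modular (PhiOf φ) Ω f < ⊤ := by
  obtain ⟨-, τ, hτ, hfin⟩ := hf
  refine lt_of_le_of_lt ?_ (ENNReal.mul_lt_top (a := ENNReal.ofReal ((max 1 τ) ^ q))
    ENNReal.ofReal_lt_top hfin)
  rw [modular, modular, ← lintegral_const_mul' _ _ ENNReal.ofReal_ne_top]
  refine setLIntegral_mono' hΩ fun x hx => ?_
  rw [← ENNReal.ofReal_mul (by positivity)]
  refine ENNReal.ofReal_le_ofReal ?_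
  refine le_trans ?_ (h.phiOf_mul_le hp hx (le_max_left 1 τ) (norm_nonneg _))
  refine h.monotoneOn_phiOf hp hx (norm_nonneg _) (mem_Ici.2 (by positivity)) ?_
  rw [norm_smul, norm_inv, Real.norm_of_nonneg hτ.le, ← mul_assoc]
  refine le_mul_of_one_le_left (norm_nonneg _) ?_
  rw [← div_eq_mul_inv, one_le_div hτ]
  exact le_max_right _ _

theorem integrableOn_phiOf {F : Type*} [NormedAddCommGroup F] [NormedSpace ℝ F]
    {Ω : Set (EuclideanSpace ℝ (Fin N))} (hΩ : MeasurableSet Ω) (h : PhiHyp Ω p q κ φ)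
    (hp : 1 < p) {f : EuclideanSpace ℝ (Fin N) → F}
    (hf : MemLPhi (PhiOf φ) Ω f) : IntegrableOn (fun x => PhiOf φ x ‖f x‖) Ω := by
  refine (lintegral_ofReal_ne_top_iff_integrable
    (h.aemeasurable_phiOf hΩ hf.1.norm.aemeasurable).aestronglyMeasurable ?_).1
    (h.modular_lt_top hΩ hp hf).ne
  filter_upwards [ae_restrict_mem hΩ] with x hx using h.phiOf_nonneg hx _

theorem ofReal_setIntegral_phiOf {F : Type*} [NormedAddCommGroup F] [NormedSpace ℝ F]
    {Ω : Set (EuclideanSpace ℝ (Fin N))} (hΩ : MeasurableSet Ω) (h : PhiHyp Ω p q κ φ)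
    (hp : 1 < p) {f : EuclideanSpace ℝ (Fin N) → F}
    (hf : MemLPhi (PhiOf φ) Ω f) :
    ENNReal.ofReal (∫ x in Ω, PhiOf φ x ‖f x‖) = modular (PhiOf φ) Ω f := by
  refine ofReal_integral_eq_lintegral_ofReal (h.integrableOn_phiOf hΩ hp hf) ?_
  filter_upwards [ae_restrict_mem hΩ] with x hx using h.phiOf_nonneg hx _

/-- For an admissible `τ ≤ 1`, convexity and `PhiOf φ x 0 = 0` bound the modular of `f` by `τ` times
that of `τ⁻¹ • f`, hence by `τ`. -/
theorem modular_le_of_luxNorm_lt {F : Type*} [NormedAddCommGroup F] [NormedSpace ℝ F]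
    {Ω : Set (EuclideanSpace ℝ (Fin N))} (hΩ : MeasurableSet Ω) (h : PhiHyp Ω p q κ φ)
    (hp : 1 < p) {f : EuclideanSpace ℝ (Fin N) → F} {ε : ENNReal} (hε : ε ≤ 1)
    (hf : luxNorm (PhiOf φ) Ω f < ε) : modular (PhiOf φ) Ω f ≤ ε := by
  obtain ⟨-, ⟨τ, ⟨hτ, hmod⟩, rfl⟩, hlt⟩ := sInf_lt_iff.1 hf
  have hτ1 : τ ≤ 1 := by
    have := hlt.le.trans hε
    rwa [ENNReal.ofReal_le_one] at this
  calc modular (PhiOf φ) Ω f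
      ≤ ENNReal.ofReal τ * modular (PhiOf φ) Ω (fun x => τ⁻¹ • f x) := by
        rw [modular, modular, ← lintegral_const_mul' _ _ ENNReal.ofReal_ne_top]
        refine setLIntegral_mono' hΩ fun x hx => ?_
        rw [← ENNReal.ofReal_mul hτ.le]
        refine ENNReal.ofReal_le_ofReal ?_
        refine le_trans (le_of_eq ?_)
          (h.phiOf_mul_le_of_le_one hp hx hτ.le hτ1 (norm_nonneg _))
        rw [norm_smul, norm_inv, Real.norm_of_nonneg hτ.le, mul_inv_cancel_left₀ hτ.ne']
    _ ≤ ENNReal.ofReal τ * 1 := by gcongr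
    _ ≤ ε := by rw [mul_one]; exact hlt.le

theorem modular_le_add {F : Type*} [NormedAddCommGroup F] [NormedSpace ℝ F]
    {Ω : Set (EuclideanSpace ℝ (Fin N))} (hΩ : MeasurableSet Ω) (h : PhiHyp Ω p q κ φ)
    (hp : 1 < p) {f f₁ f₂ : EuclideanSpace ℝ (Fin N) → F}
    (hf₁ : AEStronglyMeasurable f₁ (volume.restrict Ω)) (hf : ∀ x, ‖f x‖ ≤ ‖f₁ x‖ + ‖f₂ x‖) :
    modular (PhiOf φ) Ω f ≤
      ENNReal.ofReal (2 ^ q) * (modular (PhiOf φ) Ω f₁ + modular (PhiOf φ) Ω f₂) := by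
  rw [modular, modular, modular,
    ← lintegral_add_left' (h.aemeasurable_phiOf hΩ hf₁.norm.aemeasurable).ennreal_ofReal,
    ← lintegral_const_mul' _ _ ENNReal.ofReal_ne_top]
  refine setLIntegral_mono' hΩ fun x hx => ?_
  rw [← ENNReal.ofReal_add (h.phiOf_nonneg hx _) (h.phiOf_nonneg hx _),
    ← ENNReal.ofReal_mul (by positivity)]
  exact ENNReal.ofReal_le_ofReal
    (h.phiOf_le_of_le_add hp hx (norm_nonneg _) (norm_nonneg _) (norm_nonneg _) (hf x))

/-- The modular Poincaré inequality passes from test functions to their closure. -/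
theorem modular_le_of_memW01Phi {Ω : Set (EuclideanSpace ℝ (Fin N))} (hΩ : MeasurableSet Ω)
    (h : PhiHyp Ω p q κ φ) (hp : 1 < p) {C : ℝ}
    (hC : ∀ v, IsTestFunction Ω v →
      modular (PhiOf φ) Ω v ≤ ENNReal.ofReal C * modular (PhiOf φ) Ω (gradient v))
    {u : EuclideanSpace ℝ (Fin N) → ℝ}
    {g : EuclideanSpace ℝ (Fin N) → EuclideanSpace ℝ (Fin N)} (hu : MemW01Phi (PhiOf φ) Ω u g) :
    modular (PhiOf φ) Ω u ≤
      ENNReal.ofReal (2 ^ q) * (ENNReal.ofReal C * (ENNReal.ofReal (2 ^ q) *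
        modular (PhiOf φ) Ω g)) := by
  obtain ⟨⟨⟨hum, -⟩, -, ⟨hgm, -⟩⟩, happrox⟩ := hu
  have key : ∀ ε : ENNReal, 0 < ε → ε ≤ 1 → modular (PhiOf φ) Ω u ≤
      ENNReal.ofReal (2 ^ q) * (ε + ENNReal.ofReal C * (ENNReal.ofReal (2 ^ q) *
        (ε + modular (PhiOf φ) Ω g))) := by
    intro ε hε hε1
    obtain ⟨v, hv, hlt⟩ := happrox ε hε
    have h1 := h.modular_le_of_luxNorm_lt hΩ hp hε1 (le_self_add.trans_lt hlt)
    have h2 := h.modular_le_of_luxNorm_lt hΩ hp hε1 (le_add_self.trans_lt hlt)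
    have hvm : AEStronglyMeasurable v (volume.restrict Ω) :=
      hv.1.continuous.aestronglyMeasurable
    have hvg : AEStronglyMeasurable (gradient v) (volume.restrict Ω) :=
      (continuous_gradient_of_contDiff hv.1).aestronglyMeasurable
    -- Doubling is used twice, for `u = (u - v) + v` and for `gradient v = (gradient v - g) + g`.
    have h3 := h.modular_le_add hΩ hp (f := u) (f₂ := v) (hum.sub hvm) fun x => by
      simpa using norm_add_le (u x - v x) (v x)
    have h4 := h.modular_le_add hΩ hp (f := gradient v) (f₂ := g) (hgm.sub hvg) fun x => by
      rw [Pi.sub_apply, norm_sub_rev]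
      simpa using norm_add_le (gradient v x - g x) (g x)
    refine h3.trans ?_
    gcongr
    · exact h1
    · refine (hC v hv).trans ?_
      gcongr
      refine h4.trans ?_
      gcongr
      exact h2
  -- Let `ε → 0`; the constant factors are finite, so multiplication by them is continuous on
  -- `ENNReal`.
  have hlim : Filter.Tendsto (fun ε : ENNReal => ENNReal.ofReal (2 ^ q) *
      (ε + ENNReal.ofReal C * (ENNReal.ofReal (2 ^ q) * (ε + modular (PhiOf φ) Ω g))))
      (nhdsWithin 0 (Ioi 0)) (nhds (ENNReal.ofReal (2 ^ q) * (0 + ENNReal.ofReal C *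
        (ENNReal.ofReal (2 ^ q) * (0 + modular (PhiOf φ) Ω g))))) := by
    have hid : Filter.Tendsto (fun ε : ENNReal => ε) (nhdsWithin 0 (Ioi 0)) (nhds 0) :=
      Filter.tendsto_id.mono_left nhdsWithin_le_nhds
    have hc : ∀ (c : ℝ) {f : ENNReal → ENNReal} {a}, Filter.Tendsto f (nhdsWithin 0 (Ioi 0))
        (nhds a) → Filter.Tendsto (fun ε => ENNReal.ofReal c * f ε) (nhdsWithin 0 (Ioi 0))
        (nhds (ENNReal.ofReal c * a)) := fun c _ _ hf =>
      ENNReal.Tendsto.const_mul hf (Or.inr ENNReal.ofReal_ne_top)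
    exact hc _ (hid.add (hc _ (hc _ (hid.add tendsto_const_nhds))))
  simp only [zero_add] at hlim
  refine ge_of_tendsto hlim ?_
  filter_upwards [self_mem_nhdsWithin,
    mem_nhdsWithin_of_mem_nhds (Iic_mem_nhds (zero_lt_one' ENNReal))] with ε h1 h2 using key ε h1 h2

end PhiHyp

end Poincare

theorem lemma2p2 (N : ℕ) (p q κ : ℝ) (hp : 1 < p) (hpN : p < N) (hNq : (N : ℝ) < q)
    (hq : q < N * p / (N - p)) (hκ : 0 < κ) (hκN : κ < 1 / 2 ^ (N + 1)) :
    ∃ Υ : ℝ, 0 < Υ ∧ ∀ r : ℝ, 1 ≤ r →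
      ∀ φ : EuclideanSpace ℝ (Fin N) → ℝ → ℝ, PhiHyp (annulus N r) p q κ φ →
      ∀ (u : EuclideanSpace ℝ (Fin N) → ℝ)
        (g : EuclideanSpace ℝ (Fin N) → EuclideanSpace ℝ (Fin N)),
        MemW01Phi (PhiOf φ) (annulus N r) u g →
        IntegrableOn (fun x => PhiOf φ x |u x|) (annulus N r) ∧
        IntegrableOn (fun x => PhiOf φ x ‖g x‖) (annulus N r) ∧
        ∫ x in annulus N r, PhiOf φ x |u x| ≤ Υ * ∫ x in annulus N r, PhiOf φ x ‖g x‖ := by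
  have hN0 : (0 : ℝ) < N := by linarith
  -- The two factors `2 ^ q` come from the closure argument, `exp κ` from moving the base point, `2
  -- ^ (N - 1)` from the polar weight.
  refine ⟨2 ^ q * (Real.exp κ * 2 ^ (N - 1) * 2 ^ q), by positivity, ?_⟩
  intro r hr φ h u g hu
  have hΩ := (isOpen_annulus N r).measurableSet
  have hu₁ := h.integrableOn_phiOf hΩ hp hu.1.1
  have hu₂ := h.ofReal_setIntegral_phiOf hΩ hp hu.1.1
  simp only [Real.norm_eq_abs] at hu₁ hu₂
  refine ⟨hu₁, h.integrableOn_phiOf hΩ hp hu.1.2.2, ?_⟩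
  have hle := h.modular_le_of_memW01Phi hΩ hp (fun v hv =>
    h.modular_le_of_isTestFunction hp hκ (by exact_mod_cast hN0) hr hv) hu
  have hg0 : 0 ≤ ∫ x in annulus N r, PhiOf φ x ‖g x‖ :=
    setIntegral_nonneg hΩ fun x hx => h.phiOf_nonneg hx _
  rw [← hu₂, ← h.ofReal_setIntegral_phiOf hΩ hp hu.1.2.2, ← ENNReal.ofReal_mul (by positivity),
    ← ENNReal.ofReal_mul (by positivity), ← ENNReal.ofReal_mul (by positivity),
    ENNReal.ofReal_le_ofReal_iff (by positivity)] at hle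
  refine hle.trans_eq ?_
  ring
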